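/- Let $p\ge 3$ be a prime number and let $K$ be a field of characteristic $p$ that is complete with respect to a non-Archimedean absolute value $|\cdot|$. Call a power series over $K$ locally analytic if it converges on some disc of positive radius around $0$, and call a locally analytic power series $f(z)=\lambda z+\cdots\in K[\![z]\!]$ without constant term linearizable if there is a locally analytic power series $h(z)=b_0z+b_1z^2+\cdots\in K[\![z]\!]$, invertible under composition, such that $h\circ f\circ h^{-1}(z)=\lambda z$. Let $\lambda\in K$ be such that $\lambda$ is not a root of unity and $|1-\lambda|<1$, let $n\ge 1$ be an integer and let $a_n\in K$. Then the polynomial $\lambda z+a_nz^{n+1}\in K[z]$ is linearizable if and only if $p\mid n+1$ or $a_n=0$. -/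

import Mathlib

/-- A formal power series over a normed field is locally analytic at `0` if it converges at every
point of some disc of positive radius around `0`. -/
def IsLocallyAnalytic {K : Type*} [NormedField K] (f : PowerSeries K) : Prop :=
  ∃ r : ℝ, 0 < r ∧ ∀ z : K, ‖z‖ < r → Summable fun n : ℕ => PowerSeries.coeff n f * z ^ n

/-- A power series `f` without constant term is locally linearizable at `0` if there is a locally
analytic `h = b₀ z + b₁ z² + ⋯` with compositional inverse `g = h⁻¹` such that
`h ∘ f ∘ h⁻¹ = f'(0) z`. Here `PowerSeries.subst a F` is the composition `F ∘ a`. -/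
def IsLinearizable {K : Type*} [NormedField K] (f : PowerSeries K) : Prop :=
  ∃ h g : PowerSeries K,
    IsLocallyAnalytic h ∧
    PowerSeries.constantCoeff h = 0 ∧ PowerSeries.constantCoeff g = 0 ∧
    PowerSeries.subst g h = PowerSeries.X ∧ PowerSeries.subst h g = PowerSeries.X ∧
    PowerSeries.subst (PowerSeries.subst g f) h =
      PowerSeries.C (PowerSeries.coeff 1 f) * PowerSeries.X

/-! Linearizability amounts to a convergent solution of `h ∘ f = λ h` with nonzero linear
coefficient `b₁`. Comparing coefficients gives a triangular recursion: `b_k (λ - λ^k)` is the sum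
over `m < k` of `b_m` times the degree `k` coefficient of `f^m`, which for `k = m + n j` is `a^j
λ^(m-j) (m choose j)`. When `p ∣ m` and `p ∤ j` the binomial coefficient vanishes in `K`, so degrees
divisible by `p` feed only degrees divisible by `p`.

If `p ∣ n + 1`, every nonlinear term of `h` has degree `k` divisible by `p`
(`coeff_linearization_eq_zero`). Then `p ∤ k - 1`, so the divisor has the constant size `|1 - λ|`,
and the coefficients grow at most geometrically (`norm_coeff_linearization_le`).

If `p ∤ n + 1` and `a ≠ 0`, one term of the recursion dominates in each degree `1 + n i` prime to
`p`, so the small divisors accumulate without cancellation (`norm_coeff_linearization_eq`). By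
Frobenius, `|1 - λ^(mp)| = |1 - λ^m|^p`, which makes their product superexponential along `i =
p^(N+1)` (`inv_norm_pow_le_smallDivisorProd`). -/

namespace PowerSeries

/-! ### Formal conjugacy equation and its recursion -/

section Formal

variable {K : Type*} [Field K]

lemma coeff_pow_eq_zero_of_lt {R : Type*} [CommSemiring R] {f : PowerSeries R}
    (hf : constantCoeff f = 0) {k m : ℕ} (h : k < m) : coeff k (f ^ m) = 0 :=
  X_pow_dvd_iff.mp (pow_dvd_pow_of_dvd (X_dvd_iff.mpr hf) m) k h

lemma coeff_subst_eq_sum_range {R : Type*} [CommRing R] {f : PowerSeries R}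
    (hf : constantCoeff f = 0) (h : PowerSeries R) (k : ℕ) :
    coeff k (subst f h) = ∑ m ∈ Finset.range (k + 1), coeff m h * coeff k (f ^ m) := by
  rw [coeff_subst' (HasSubst.of_constantCoeff_zero' hf)]
  simp only [smul_eq_mul]
  apply finsum_eq_finsetSum_of_support_subset
  intro m hm
  by_contra hmk
  simp only [Finset.coe_range, Set.mem_Iio, not_lt] at hmk
  exact hm (by simp [coeff_pow_eq_zero_of_lt hf (show k < m by omega)])

/-- The power series `l X + a X ^ (n + 1)`. -/
noncomputable def linearAddMonomial (l a : K) (n : ℕ) : PowerSeries K :=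
  C l * X + C a * X ^ (n + 1)

lemma constantCoeff_linearAddMonomial (l a : K) (n : ℕ) :
    constantCoeff (linearAddMonomial l a n) = 0 := by
  simp [linearAddMonomial]

lemma coeff_one_linearAddMonomial (l a : K) {n : ℕ} (hn : 1 ≤ n) :
    coeff 1 (linearAddMonomial l a n) = l := by
  simp [linearAddMonomial, coeff_X_pow]
  omega

lemma linearAddMonomial_pow (l a : K) (n m : ℕ) :
    linearAddMonomial l a n ^ m =
      ∑ j ∈ Finset.range (m + 1), C (a ^ j * l ^ (m - j) * (m.choose j : K)) * X ^ (m + n * j) := by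
  rw [linearAddMonomial, add_comm, add_pow]
  refine Finset.sum_congr rfl fun j hj => ?_
  have hj' : j ≤ m := by simpa [Nat.lt_succ_iff] using hj
  have : m + n * j = (n + 1) * j + (m - j) := by
    obtain ⟨d, rfl⟩ := Nat.exists_eq_add_of_le hj'
    rw [Nat.add_sub_cancel_left]; ring
  rw [this, mul_pow, mul_pow, ← pow_mul]
  simp only [map_mul, map_pow, map_natCast, pow_add]
  ring

lemma coeff_linearAddMonomial_pow (l a : K) {n : ℕ} (hn : 1 ≤ n) (m j : ℕ) :
    coeff (m + n * j) (linearAddMonomial l a n ^ m) = a ^ j * l ^ (m - j) * (m.choose j : K) := by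
  rw [linearAddMonomial_pow, map_sum]
  simp only [coeff_C_mul, coeff_X_pow]
  rw [Finset.sum_eq_single j]
  · simp
  · intro i _ hij
    rw [if_neg, mul_zero]
    intro h
    exact hij (Nat.eq_of_mul_eq_mul_left hn (by omega : n * i = n * j))
  · intro hj
    rw [Nat.choose_eq_zero_of_lt (by simpa using hj)]
    simp

lemma coeff_linearAddMonomial_pow_eq_zero (l a : K) {n m k : ℕ}
    (h : ∀ j, k ≠ m + n * j) :
    coeff k (linearAddMonomial l a n ^ m) = 0 := by
  rw [linearAddMonomial_pow, map_sum]
  refine Finset.sum_eq_zero fun j _ => ?_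
  rw [coeff_C_mul, coeff_X_pow, if_neg (h j), mul_zero]

/-- The coefficientwise form of the conjugacy equation `h ∘ f = l h`. -/
lemma subst_linearAddMonomial_eq_iff (l a : K) {n : ℕ} (hn : 1 ≤ n) (h : PowerSeries K) :
    subst (linearAddMonomial l a n) h = C l * h ↔
      ∀ k, coeff k h * (l - l ^ k) =
        ∑ m ∈ Finset.range k, coeff m h * coeff k (linearAddMonomial l a n ^ m) := by
  rw [PowerSeries.ext_iff]
  refine forall_congr' fun k => ?_
  have hk : coeff k (linearAddMonomial l a n ^ k) = l ^ k := by
    simpa using coeff_linearAddMonomial_pow l a hn k 0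
  rw [coeff_subst_eq_sum_range (constantCoeff_linearAddMonomial l a n), Finset.sum_range_succ, hk,
    coeff_C_mul]
  constructor <;> intro H <;> linear_combination -H

/-- A triangular linear system over a field with non-vanishing diagonal can be solved. -/
lemma exists_triangular_solution (d y : ℕ → K) (A : ℕ → ℕ → K) (hd : ∀ k, d k ≠ 0) :
    ∃ b : ℕ → K, ∀ k, b k * d k = y k + ∑ m ∈ Finset.range k, b m * A m k := by
  let b : ℕ → K := fun k => Nat.strongRec
    (fun k ih => (y k + ∑ m : Fin k, ih m.1 m.2 * A m.1 k) / d k) k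
  refine ⟨b, fun k => ?_⟩
  have : b k = (y k + ∑ m : Fin k, b m.1 * A m.1 k) / d k := by
    simp only [b]
    rw [Nat.strongRec_eq]
  rw [this, div_mul_cancel₀ _ (hd k), Finset.sum_range (fun m => b m * A m k)]

lemma exists_formal_linearization {l : K} (hl0 : l ≠ 0) (hroot : ∀ m : ℕ, 0 < m → l ^ m ≠ 1)
    (a : K) {n : ℕ} (hn : 1 ≤ n) :
    ∃ h : PowerSeries K, constantCoeff h = 0 ∧ coeff 1 h = 1 ∧
      subst (linearAddMonomial l a n) h = C l * h := by
  have hne : ∀ k, k ≠ 0 → k ≠ 1 → l - l ^ k ≠ 0 := by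
    intro k h0 h1 hk
    obtain ⟨j, rfl⟩ : ∃ j, k = j + 1 + 1 := ⟨k - 2, by omega⟩
    refine hroot (j + 1) (by omega) (mul_right_cancel₀ hl0 ?_)
    rw [← pow_succ, one_mul]
    exact (sub_eq_zero.mp hk).symm
  -- The true diagonal vanishes at `k = 1`. Rows 0 and 1 are replaced by the normalizations `b 0 =
  -- 0` and `b 1 = 1`; the original equations in these degrees then hold because `b 0 = 0`.
  obtain ⟨b, hb⟩ := exists_triangular_solution
    (fun k => if k = 0 ∨ k = 1 then 1 else l - l ^ k) (fun k => if k = 1 then 1 else 0)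
    (fun m k => if k = 1 then 0 else coeff k (linearAddMonomial l a n ^ m))
    (by
      intro k
      split_ifs with h
      · exact one_ne_zero
      · exact hne k (fun h0 => h (Or.inl h0)) (fun h1 => h (Or.inr h1)))
  have b0 : b 0 = 0 := by simpa using hb 0
  have b1 : b 1 = 1 := by simpa using hb 1
  refine ⟨mk b, by simpa using b0, by simpa using b1, ?_⟩
  rw [subst_linearAddMonomial_eq_iff l a hn]
  intro k
  simp only [coeff_mk]
  rcases eq_or_ne k 0 with rfl | h0
  · simp [b0]
  rcases eq_or_ne k 1 with rfl | h1
  · simp [b0]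
  · simpa [h0, h1] using hb k

end Formal

end PowerSeries

-- Composing with `h` on the right removes `h⁻¹`. Conversely, a nonzero linear coefficient already
-- provides a formal inverse, and only `h` has to converge.
open PowerSeries in
lemma isLinearizable_iff_exists_semiconj {K : Type*} [NormedField K] {f : PowerSeries K}
    (hf : constantCoeff f = 0) :
    IsLinearizable f ↔ ∃ h : PowerSeries K, IsLocallyAnalytic h ∧ constantCoeff h = 0 ∧
      coeff 1 h ≠ 0 ∧ subst f h = C (coeff 1 f) * h := by
  have hfs := HasSubst.of_constantCoeff_zero' hf
  constructor
  · rintro ⟨h, g, hh, h0, g0, hg, gh, H⟩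
    have hhs := HasSubst.of_constantCoeff_zero' h0
    have hgs := HasSubst.of_constantCoeff_zero' g0
    have hfg : constantCoeff (subst g f) = 0 := by
      exact constantCoeff_subst_eq_zero g0 f hf
    refine ⟨h, hh, h0, ?_, ?_⟩
    · intro h1
      have := congrArg (coeff 1) hg
      rw [coeff_subst_eq_sum_range g0] at this
      simp [Finset.sum_range_succ, h1] at this
    · have := congrArg (subst h) H
      rw [subst_comp_subst_apply (HasSubst.of_constantCoeff_zero' hfg) hhs,
        subst_comp_subst_apply hgs hhs, gh, X_subst, subst_mul hhs, subst_X hhs] at this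
      rw [this]
      congr 1
      exact subst_C _
  · rintro ⟨h, hh, h0, h1, H⟩
    have hu : IsUnit (coeff 1 h) := isUnit_iff_ne_zero.mpr h1
    have g0 := constantCoeff_substInvOfIsUnit h hu
    have hgs := HasSubst.of_constantCoeff_zero' g0
    refine ⟨h, h.substInvOfIsUnit hu, hh, h0, g0, subst_substInvOfIsUnit_right h h0 hu,
      subst_substInvOfIsUnit_left h h0 hu, ?_⟩
    rw [← subst_comp_subst_apply hfs hgs, H, subst_mul hgs,
      subst_substInvOfIsUnit_right h h0 hu]
    congr 1
    exact subst_C _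

/-! ### Absolute values of integers, binomial coefficients and `1 - λ^m` -/

section Ultrametric

variable {K : Type*} [NormedField K]

/-- By Euler's theorem, the image of `m` in `K` is a root of unity. -/
lemma norm_natCast_eq_one_of_not_dvd {p : ℕ} (hp : p.Prime) [CharP K p] {m : ℕ} (hm : ¬ p ∣ m) :
    ‖(m : K)‖ = 1 := by
  have hmod := Nat.ModEq.pow_totient ((hp.coprime_iff_not_dvd.mpr hm).symm)
  have hK : (m : K) ^ p.totient = 1 := by
    exact_mod_cast (CharP.natCast_eq_natCast' K p hmod)
  have := congrArg norm hK
  rw [norm_pow, norm_one] at this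
  exact (pow_eq_one_iff_of_nonneg (norm_nonneg _) (Nat.totient_pos.mpr hp.pos).ne').mp this

lemma norm_one_sub_pow_mul_char {p : ℕ} (hp : p.Prime) [CharP K p] (l : K) (m : ℕ) :
    ‖1 - l ^ (m * p)‖ = ‖1 - l ^ m‖ ^ p := by
  have : Fact p.Prime := ⟨hp⟩
  rw [← norm_pow, sub_pow_char, one_pow, pow_mul]

/-- The identity `j (m choose j) = m (m-1 choose j-1)` puts a factor `p` on the left, and `j` cannot
supply it. -/
lemma natCast_choose_eq_zero {p : ℕ} (hp : p.Prime) [CharP K p] {m j : ℕ} (hm : p ∣ m)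
    (hj : ¬ p ∣ j) : (m.choose j : K) = 0 := by
  rw [CharP.cast_eq_zero_iff K p]
  obtain _ | j := j
  · simp at hj
  obtain _ | m := m
  · simp
  · have h := Nat.add_one_mul_choose_eq m j
    have : p ∣ (m + 1).choose (j + 1) * (j + 1) := h ▸ hm.mul_right _
    exact (hp.dvd_mul.mp this).resolve_right hj

variable [IsUltrametricDist K]

lemma norm_sum_eq_of_forall_lt {ι : Type*} [DecidableEq ι] {s : Finset ι} {t : ι → K} {i₀ : ι}
    (hi₀ : i₀ ∈ s) (h0 : 0 < ‖t i₀‖) (h : ∀ i ∈ s, i ≠ i₀ → ‖t i‖ < ‖t i₀‖) :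
    ‖∑ i ∈ s, t i‖ = ‖t i₀‖ := by
  have hrest : ‖∑ i ∈ s.erase i₀, t i‖ < ‖t i₀‖ := by
    rcases (s.erase i₀).eq_empty_or_nonempty with he | hne
    · simpa [he] using h0
    · obtain ⟨i, hi, hle⟩ := IsUltrametricDist.exists_norm_finsetSum_le_of_nonempty hne t
      exact hle.trans_lt (h i (Finset.mem_of_mem_erase hi) (Finset.ne_of_mem_erase hi))
  rw [← Finset.add_sum_erase s t hi₀,
    IsUltrametricDist.norm_add_eq_max_of_norm_ne_norm hrest.ne', max_eq_left hrest.le]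

lemma norm_eq_one_of_norm_one_sub_lt_one {l : K} (hl : ‖1 - l‖ < 1) : ‖l‖ = 1 := by
  have := IsUltrametricDist.norm_eq_of_add_norm_lt_max (x := 1) (y := -l)
    (by rw [← sub_eq_add_neg]; exact hl.trans_le (by simp))
  simpa using this.symm

lemma norm_one_sub_pow_le {l : K} (hl : ‖1 - l‖ < 1) (m : ℕ) : ‖1 - l ^ m‖ ≤ ‖1 - l‖ := by
  induction m with
  | zero => simp
  | succ m ih =>
    have : 1 - l ^ (m + 1) = (1 - l) + l * (1 - l ^ m) := by ring
    rw [this]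
    refine (IsUltrametricDist.norm_add_le_max _ _).trans (max_le le_rfl ?_)
    rwa [norm_mul, norm_eq_one_of_norm_one_sub_lt_one hl, one_mul]

/-- The cofactor of `1 - l` in `1 - l^m` is a geometric sum. It differs from `m`, of absolute value
1, by something of absolute value less than 1. -/
lemma norm_one_sub_pow_eq {p : ℕ} (hp : p.Prime) [CharP K p] {l : K} (hl : ‖1 - l‖ < 1) {m : ℕ}
    (hm : ¬ p ∣ m) : ‖1 - l ^ m‖ = ‖1 - l‖ := by
  have hsum : ‖∑ i ∈ Finset.range m, l ^ i‖ = 1 := by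
    have hsplit : ∑ i ∈ Finset.range m, l ^ i = (m : K) + -∑ i ∈ Finset.range m, (1 - l ^ i) := by
      simp [Finset.sum_sub_distrib]
    have hlt : ‖-∑ i ∈ Finset.range m, (1 - l ^ i)‖ < 1 := by
      rw [norm_neg]
      exact (IsUltrametricDist.norm_sum_le_of_forall_le_of_nonneg (norm_nonneg (1 - l))
        fun i _ => norm_one_sub_pow_le hl i).trans_lt hl
    have hm1 := norm_natCast_eq_one_of_not_dvd (K := K) hp hm
    rw [hsplit, IsUltrametricDist.norm_add_eq_max_of_norm_ne_norm (by rw [hm1]; exact hlt.ne'),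
      hm1, max_eq_left hlt.le]
  rw [← mul_neg_geom_sum, norm_mul, hsum, mul_one]

lemma norm_binomial_coeff_le (l a : K) (hl : ‖l‖ = 1) (m j : ℕ) :
    ‖a ^ j * l ^ (m - j) * (m.choose j : K)‖ ≤ ‖a‖ ^ j := by
  rw [norm_mul, norm_mul, norm_pow, norm_pow, hl, one_pow, mul_one]
  exact mul_le_of_le_one_right (by positivity) (IsUltrametricDist.norm_natCast_le_one K _)

end Ultrametric

/-! ### Convergence in terms of coefficient growth -/

section Analytic

variable {K : Type*} [NormedField K]

open PowerSeries

lemma IsLocallyAnalytic.of_norm_coeff_le [CompleteSpace K] {h : PowerSeries K} {M : ℝ} (hM : 0 < M)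
    (hb : ∀ k, ‖coeff k h‖ ≤ M ^ k) : IsLocallyAnalytic h := by
  refine ⟨M⁻¹, inv_pos.mpr hM, fun z hz => ?_⟩
  have h1 : M * ‖z‖ < 1 := by
    calc M * ‖z‖ < M * M⁻¹ := mul_lt_mul_of_pos_left hz hM
      _ = 1 := mul_inv_cancel₀ hM.ne'
  refine Summable.of_norm_bounded (summable_geometric_of_lt_one (by positivity) h1) fun k => ?_
  rw [norm_mul, norm_pow, mul_pow]
  exact mul_le_mul_of_nonneg_right (hb k) (by positivity)

/-- The element `t` ensures that every disc contains a nonzero point, namely a high power of `t`;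
over a trivially valued field small discs reduce to `0`. -/
lemma IsLocallyAnalytic.exists_norm_coeff_bound {h : PowerSeries K} (hh : IsLocallyAnalytic h)
    {t : K} (ht0 : t ≠ 0) (ht : ‖t‖ < 1) :
    ∃ z : K, z ≠ 0 ∧ ∃ c : ℝ, ∀ k, ‖coeff k h‖ * ‖z‖ ^ k ≤ c := by
  obtain ⟨r, hr, hsum⟩ := hh
  obtain ⟨s, hs⟩ := exists_pow_lt_of_lt_one hr ht
  refine ⟨t ^ s, pow_ne_zero _ ht0, ?_⟩
  have := (hsum (t ^ s) (by rwa [norm_pow])).tendsto_atTop_zero.norm.bddAbove_range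
  obtain ⟨c, hc⟩ := this
  refine ⟨c, fun k => ?_⟩
  have := hc ⟨k, rfl⟩
  simpa only [norm_mul, norm_pow] using this

end Analytic

/-! ### The case `p ∣ n + 1` -/

section Convergence

open PowerSeries

variable {K : Type*} [NormedField K]

/-- If `p ∣ n + 1`, the formal linearization of `l X + a X ^ (n + 1)` is a power series
in `X ^ p`, up to its linear term. -/
lemma coeff_linearization_eq_zero {p : ℕ} (hp : p.Prime) [CharP K p] {l a : K} (hl0 : l ≠ 0)
    (hroot : ∀ m : ℕ, 0 < m → l ^ m ≠ 1) {n : ℕ} (hn : 1 ≤ n) (hpn : p ∣ n + 1)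
    {h : PowerSeries K}
    (H : subst (linearAddMonomial l a n) h = C l * h) {k : ℕ} (hk1 : k ≠ 1) (hk : ¬ p ∣ k) :
    coeff k h = 0 := by
  rw [subst_linearAddMonomial_eq_iff l a hn] at H
  induction k using Nat.strong_induction_on with
  | _ k ih =>
    have hk0 : k ≠ 0 := by rintro rfl; simp at hk
    have hne : l - l ^ k ≠ 0 := by
      intro hz
      obtain ⟨j, rfl⟩ : ∃ j, k = j + 1 + 1 := ⟨k - 2, by omega⟩
      refine hroot (j + 1) (by omega) (mul_right_cancel₀ hl0 ?_)
      rw [← pow_succ, one_mul]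
      exact (sub_eq_zero.mp hz).symm
    refine (mul_eq_zero.mp ((H k).trans (Finset.sum_eq_zero fun m hm => ?_))).resolve_right hne
    have hmk : m < k := Finset.mem_range.mp hm
    by_cases hex : ∃ j, k = m + n * j
    · obtain ⟨j, rfl⟩ := hex
      rw [coeff_linearAddMonomial_pow l a hn]
      -- The linear term reaches only degrees `1` and `n + 1`, and the latter is divisible by `p`.
      rcases eq_or_ne m 1 with rfl | hm1
      · obtain _ | _ | j := j
        · simp at hk1
        · exact absurd (by simpa [add_comm] using hpn) hk
        · simp [Nat.choose_eq_zero_of_lt (show 1 < j + 1 + 1 by omega)]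
      · by_cases hpm : p ∣ m
        · have hj : ¬ p ∣ j := fun hj => hk (dvd_add hpm (hj.mul_left n))
          rw [natCast_choose_eq_zero hp hpm hj, mul_zero, mul_zero]
        · rw [ih m hmk hm1 hpm, zero_mul]
    · rw [coeff_linearAddMonomial_pow_eq_zero l a (fun j hj => hex ⟨j, hj⟩), mul_zero]

variable [IsUltrametricDist K]

/-- Small divisors do not occur: a nonzero coefficient of degree `k > 1` has `p ∣ k`, hence `p ∤ k -
1` and `|l - l^k| = |1 - l|`. -/
lemma norm_coeff_linearization_le {p : ℕ} (hp : p.Prime) [CharP K p] {l a : K}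
    (hroot : ∀ m : ℕ, 0 < m → l ^ m ≠ 1) (hl : ‖1 - l‖ < 1) {n : ℕ} (hn : 1 ≤ n)
    (hpn : p ∣ n + 1) {h : PowerSeries K} (h0 : constantCoeff h = 0) (h1 : coeff 1 h = 1)
    (H : subst (linearAddMonomial l a n) h = C l * h) (k : ℕ) :
    ‖coeff k h‖ ≤ max 1 (‖a‖ / ‖1 - l‖) ^ k := by
  have hl1 := norm_eq_one_of_norm_one_sub_lt_one hl
  have hl0 : l ≠ 0 := by rintro rfl; simp at hl1
  have hρ : 0 < ‖1 - l‖ := by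
    rw [norm_pos_iff, sub_ne_zero]
    intro h
    exact hroot 1 one_pos (by rw [pow_one, ← h])
  have hvan := fun k => coeff_linearization_eq_zero hp hl0 hroot hn hpn H (k := k)
  rw [subst_linearAddMonomial_eq_iff l a hn] at H
  set ρ := ‖1 - l‖
  set M := max 1 (‖a‖ / ρ)
  have hM1 : 1 ≤ M := le_max_left _ _
  have hM0 : 0 < M := one_pos.trans_le hM1
  have haM : ‖a‖ ≤ M * ρ := (div_le_iff₀ hρ).mp (le_max_right _ _)
  induction k using Nat.strong_induction_on with
  | _ k ih =>
    rcases eq_or_ne k 0 with rfl | hk0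
    · simp [h0]
    rcases eq_or_ne k 1 with rfl | hk1
    · simpa [h1] using hM1
    by_cases hpk : p ∣ k
    swap
    · rw [hvan k hk1 hpk, norm_zero]
      positivity
    obtain ⟨k', rfl⟩ : ∃ k', k = k' + 1 := ⟨k - 1, by omega⟩
    have hk' : ¬ p ∣ k' := fun hd => hp.one_lt.ne' (Nat.dvd_one.mp ((Nat.dvd_add_right hd).mp hpk))
    have hdiv : ‖l - l ^ (k' + 1)‖ = ρ := by
      rw [show l - l ^ (k' + 1) = l * (1 - l ^ k') by ring, norm_mul, hl1, one_mul,
        norm_one_sub_pow_eq hp hl hk']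
    refine le_of_mul_le_mul_right ?_ hρ
    rw [← hdiv, ← norm_mul, H, hdiv]
    refine IsUltrametricDist.norm_sum_le_of_forall_le_of_nonneg (by positivity) fun m hm => ?_
    have hmk : m < k' + 1 := Finset.mem_range.mp hm
    by_cases hex : ∃ j, k' + 1 = m + n * j
    · obtain ⟨j, hj⟩ := hex
      obtain _ | j := j
      · omega
      rw [hj, coeff_linearAddMonomial_pow l a hn, norm_mul, pow_add M, mul_assoc (M ^ m)]
      refine mul_le_mul (ih m hmk) ((norm_binomial_coeff_le l a hl1 m _).trans ?_)
        (norm_nonneg _) (by positivity)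
      -- The choice of `M` gives a factor `ρ` for each factor `a`; as the exponent is positive, one
      -- `ρ` remains to pay for the divisor.
      calc ‖a‖ ^ (j + 1) ≤ (M * ρ) ^ (j + 1) := by gcongr
        _ = M ^ (j + 1) * ρ ^ (j + 1) := mul_pow _ _ _
        _ ≤ M ^ (n * (j + 1)) * ρ := by
          refine mul_le_mul (pow_le_pow_right₀ hM1 (Nat.le_mul_of_pos_left _ hn))
            (pow_le_of_le_one hρ.le hl.le (by omega)) (by positivity) (by positivity)
    · rw [coeff_linearAddMonomial_pow_eq_zero l a (fun j hj => hex ⟨j, hj⟩), mul_zero, norm_zero]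
      positivity

end Convergence

/-! ### The case `p ∤ n + 1`, `a ≠ 0` -/

section Divergence

/-- A product over `1, …, p m` whose factors at the multiples of `p` are `p`-th powers. -/
lemma pow_mul_prod_pow_le_prod_range_mul {p : ℕ} (hp : 0 < p) {u w : ℕ → ℝ} {c : ℝ} (hc : 0 ≤ c)
    (hu : ∀ x, 0 ≤ u x) (hw : ∀ x, ¬ p ∣ x → c ≤ w x) (huw : ∀ x, w (p * x) = u x ^ p) (m : ℕ) :
    c ^ ((p - 1) * m) * (∏ x ∈ Finset.range m, u (x + 1)) ^ p ≤
      ∏ x ∈ Finset.range (p * m), w (x + 1) := by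
  induction m with
  | zero => simp
  | succ m ih =>
    have hblock : c ^ (p - 1) * u (m + 1) ^ p ≤ ∏ y ∈ Finset.range p, w (p * m + y + 1) := by
      obtain ⟨q, rfl⟩ : ∃ q, p = q + 1 := ⟨p - 1, by omega⟩
      rw [Finset.prod_range_succ, Nat.add_sub_cancel,
        show (q + 1) * m + q + 1 = (q + 1) * (m + 1) by ring, huw]
      refine mul_le_mul_of_nonneg_right ?_ (pow_nonneg (hu _) _)
      calc c ^ q = ∏ _y ∈ Finset.range q, c := by simp
        _ ≤ _ := Finset.prod_le_prod (fun _ _ => hc) fun y hy => hw _ fun hd => by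
          have hd' : q + 1 ∣ y + 1 := by
            rw [add_assoc] at hd
            exact (Nat.dvd_add_right (dvd_mul_right _ _)).mp hd
          have := Nat.le_of_dvd (Nat.succ_pos _) hd'
          have := Finset.mem_range.mp hy
          omega
    have hub : 0 ≤ c ^ (p - 1) * u (m + 1) ^ p := mul_nonneg (pow_nonneg hc _) (pow_nonneg (hu _) _)
    have hprod : 0 ≤ ∏ x ∈ Finset.range (p * m), w (x + 1) :=
      le_trans (mul_nonneg (pow_nonneg hc _)
        (pow_nonneg (Finset.prod_nonneg fun _ _ => hu _) _)) ih
    rw [mul_add p, mul_one, Finset.prod_range_add _ (p * m), Finset.prod_range_succ, mul_pow, mul_add,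
      mul_one, pow_add]
    calc _ = (c ^ ((p - 1) * m) * (∏ x ∈ Finset.range m, u (x + 1)) ^ p) *
          (c ^ (p - 1) * u (m + 1) ^ p) := by ring
      _ ≤ _ := mul_le_mul ih hblock hub hprod

variable {K : Type*} [NormedField K]

/-- The factor contributed by the small divisor of the term of degree `n * i + 1`; the terms of
degree divisible by `p` do not contribute. -/
noncomputable def smallDivisorFactor (p : ℕ) (l : K) (n i : ℕ) : ℝ :=
  if p ∣ 1 + n * i then 1 else ‖1 - l ^ (n * i)‖⁻¹

/-- The product of the contributing small divisors up to index `i`. -/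
noncomputable def smallDivisorProd (p : ℕ) (l : K) (n i : ℕ) : ℝ :=
  ∏ x ∈ Finset.range i, smallDivisorFactor p l n (x + 1)

lemma one_lt_inv_norm_one_sub {l : K} (hroot : ∀ m : ℕ, 0 < m → l ^ m ≠ 1) (hl : ‖1 - l‖ < 1) :
    1 < ‖1 - l‖⁻¹ :=
  (one_lt_inv₀ (norm_pos_iff.mpr (sub_ne_zero.mpr (by simpa using (hroot 1 one_pos).symm)))).mpr hl

lemma smallDivisorProd_succ (p : ℕ) (l : K) (n i : ℕ) :
    smallDivisorProd p l n (i + 1) =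
      smallDivisorProd p l n i * smallDivisorFactor p l n (i + 1) :=
  Finset.prod_range_succ _ _

variable [IsUltrametricDist K]

lemma inv_norm_le_inv_norm_one_sub_pow {l : K} (hroot : ∀ m : ℕ, 0 < m → l ^ m ≠ 1)
    (hl : ‖1 - l‖ < 1) {m : ℕ} (hm : 0 < m) : ‖1 - l‖⁻¹ ≤ ‖1 - l ^ m‖⁻¹ :=
  inv_anti₀ (norm_pos_iff.mpr (sub_ne_zero.mpr (hroot m hm).symm)) (norm_one_sub_pow_le hl m)

lemma one_le_smallDivisorFactor (p : ℕ) {l : K} (hroot : ∀ m : ℕ, 0 < m → l ^ m ≠ 1)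
    (hl : ‖1 - l‖ < 1) {n i : ℕ} (hn : 1 ≤ n) (hi : 0 < i) : 1 ≤ smallDivisorFactor p l n i := by
  rw [smallDivisorFactor]
  split_ifs
  · exact le_rfl
  · exact (one_lt_inv_norm_one_sub hroot hl).le.trans
      (inv_norm_le_inv_norm_one_sub_pow hroot hl (Nat.mul_pos hn hi))

lemma one_le_smallDivisorProd (p : ℕ) {l : K} (hroot : ∀ m : ℕ, 0 < m → l ^ m ≠ 1)
    (hl : ‖1 - l‖ < 1) {n : ℕ} (hn : 1 ≤ n) (i : ℕ) : 1 ≤ smallDivisorProd p l n i := by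
  induction i with
  | zero => simp [smallDivisorProd]
  | succ i ih =>
    rw [smallDivisorProd_succ]
    exact one_le_mul_of_one_le_of_one_le ih (one_le_smallDivisorFactor p hroot hl hn i.succ_pos)

lemma smallDivisorProd_mono (p : ℕ) {l : K} (hroot : ∀ m : ℕ, 0 < m → l ^ m ≠ 1)
    (hl : ‖1 - l‖ < 1) {n : ℕ} (hn : 1 ≤ n) : Monotone (smallDivisorProd p l n) := by
  refine monotone_nat_of_le_succ fun i => ?_
  rw [smallDivisorProd_succ]
  exact le_mul_of_one_le_right (zero_le_one.trans (one_le_smallDivisorProd p hroot hl hn i))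
    (one_le_smallDivisorFactor p hroot hl hn i.succ_pos)

lemma smallDivisorProd_lt {p : ℕ} {l : K} (hroot : ∀ m : ℕ, 0 < m → l ^ m ≠ 1)
    (hl : ‖1 - l‖ < 1) {n : ℕ} (hn : 1 ≤ n) {i j : ℕ} (hij : i < j) (hj : ¬ p ∣ 1 + n * j) :
    smallDivisorProd p l n i < smallDivisorProd p l n j := by
  obtain ⟨j, rfl⟩ : ∃ j', j = j' + 1 := ⟨j - 1, by omega⟩
  refine (smallDivisorProd_mono p hroot hl hn (Nat.lt_succ_iff.mp hij)).trans_lt ?_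
  rw [smallDivisorProd_succ, smallDivisorFactor, if_neg hj]
  exact lt_mul_of_one_lt_right (one_pos.trans_le (one_le_smallDivisorProd p hroot hl hn j))
    ((one_lt_inv_norm_one_sub hroot hl).trans_le
      (inv_norm_le_inv_norm_one_sub_pow hroot hl (Nat.mul_pos hn j.succ_pos)))

/-- The product of the small divisors grows faster than any geometric sequence. -/
lemma inv_norm_pow_le_smallDivisorProd {p : ℕ} (hp : p.Prime) [CharP K p] {l : K}
    (hroot : ∀ m : ℕ, 0 < m → l ^ m ≠ 1) (hl : ‖1 - l‖ < 1) {n : ℕ} (hn : 1 ≤ n) (N : ℕ) :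
    ‖1 - l‖⁻¹ ^ (N * p ^ N) ≤ smallDivisorProd p l n (p ^ (N + 1)) := by
  have hR := (one_lt_inv_norm_one_sub hroot hl).le
  set R := ‖1 - l‖⁻¹
  let u : ℕ → ℝ := fun x => ‖1 - l ^ (n * x)‖⁻¹
  have hu : ∀ x, 0 ≤ u x := fun x => inv_nonneg.mpr (norm_nonneg _)
  have hup : ∀ x, u (p * x) = u x ^ p := fun x => by
    simp only [u]
    rw [show n * (p * x) = n * x * p by ring, norm_one_sub_pow_mul_char hp, inv_pow]
  have hpos : ∀ x, ¬ p ∣ x → 0 < x := fun x hx => Nat.pos_of_ne_zero fun h => hx (h ▸ dvd_zero p)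
  -- Passing from `p^N` to `p^(N+1)` raises the product to the `p`-th power and gains at least
  -- `R^((p-1) p^N)`; this extra gain is what beats geometric growth.
  have key : ∀ N : ℕ, R ^ (N * p ^ N) ≤ (∏ x ∈ Finset.range (p ^ N), u (x + 1)) ^ p := by
    intro N
    induction N with
    | zero =>
      simp only [zero_mul, pow_zero, Finset.range_one, Finset.prod_singleton, zero_add]
      exact one_le_pow₀ (hR.trans (inv_norm_le_inv_norm_one_sub_pow hroot hl (by omega)))
    | succ N ih =>
      have step := pow_mul_prod_pow_le_prod_range_mul hp.pos (c := R) (zero_le_one.trans hR) hu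
        (fun x hx => inv_norm_le_inv_norm_one_sub_pow hroot hl (Nat.mul_pos hn (hpos x hx)))
        hup (p ^ N)
      rw [pow_succ' p N]
      refine le_trans ?_ (pow_le_pow_left₀ (by positivity) step p)
      have h1 : R ^ (p * p ^ N) ≤ R ^ ((p - 1) * p ^ N * p) := by
        refine pow_le_pow_right₀ hR ?_
        have : 1 ≤ p - 1 := by have := hp.two_le; omega
        nlinarith [Nat.mul_le_mul_right (p ^ N * p) this]
      calc R ^ ((N + 1) * (p * p ^ N)) = R ^ (p * p ^ N) * (R ^ (N * p ^ N)) ^ p := by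
            rw [← pow_mul, ← pow_add]; congr 1; ring
        _ ≤ R ^ ((p - 1) * p ^ N * p) * ((∏ x ∈ Finset.range (p ^ N), u (x + 1)) ^ p) ^ p := by
            gcongr
        _ = _ := by rw [mul_pow, ← pow_mul R]
  -- In the actual product some factors with `p ∤ x` are replaced by 1, so only the lower bound 1 is
  -- used there. Those with `p ∣ x` all survive, since then `p ∤ 1 + n x`.
  have hfac : ∀ x, ¬ p ∣ x → 1 ≤ smallDivisorFactor p l n x := fun x hx =>
    one_le_smallDivisorFactor p hroot hl hn (hpos x hx)
  have hlast := pow_mul_prod_pow_le_prod_range_mul hp.pos zero_le_one hu hfac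
    (fun x => by
      rw [← hup, smallDivisorFactor, if_neg]
      intro hd
      exact hp.one_lt.ne' (Nat.dvd_one.mp
        ((Nat.dvd_add_left (Dvd.intro _ (by ring : p * (n * x) = n * (p * x)))).mp hd)))
    (p ^ N)
  rw [one_pow, one_mul, ← pow_succ'] at hlast
  exact (key N).trans hlast

open PowerSeries

/-- The exact size of the coefficients of the linearization of `l X + a X ^ (n + 1)` in degrees
`1 + n * i` prime to `p`: the sum defining such a coefficient has a unique dominant term. -/
lemma norm_coeff_linearization_eq {p : ℕ} (hp : p.Prime) [CharP K p] {l a : K}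
    (hroot : ∀ m : ℕ, 0 < m → l ^ m ≠ 1) (hl : ‖1 - l‖ < 1) {n : ℕ} (hn : 1 ≤ n)
    (hpn : ¬ p ∣ n + 1) (ha : a ≠ 0) {h : PowerSeries K} (h0 : constantCoeff h = 0)
    (h1 : coeff 1 h ≠ 0) (H : subst (linearAddMonomial l a n) h = C l * h) {i : ℕ}
    (hi : ¬ p ∣ 1 + n * i) :
    ‖coeff (1 + n * i) h‖ = ‖coeff 1 h‖ * ‖a‖ ^ i * smallDivisorProd p l n i := by
  have hl1 := norm_eq_one_of_norm_one_sub_lt_one hl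
  rw [subst_linearAddMonomial_eq_iff l a hn] at H
  have hb1 : 0 < ‖coeff 1 h‖ := norm_pos_iff.mpr h1
  have ha' : 0 < ‖a‖ := norm_pos_iff.mpr ha
  have hB := fun i => one_pos.trans_le (one_le_smallDivisorProd p hroot hl hn i)
  induction i using Nat.strong_induction_on with
  | _ i ih =>
    rcases Nat.eq_zero_or_pos i with rfl | hi0
    · simp [smallDivisorProd]
    -- the dominant index is the last contributing one before `i`
    obtain ⟨i₀, j₀, hij, hj₀, hgood, hchoose, hprod, hlast⟩ : ∃ i₀ j₀, i = i₀ + j₀ ∧ 0 < j₀ ∧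
        ¬ p ∣ 1 + n * i₀ ∧ ¬ p ∣ (1 + n * i₀).choose j₀ ∧
        smallDivisorProd p l n i = smallDivisorProd p l n i₀ * ‖1 - l ^ (n * i)‖⁻¹ ∧
        ∀ i', i' < i → ¬ p ∣ 1 + n * i' → i' ≤ i₀ := by
      obtain ⟨e, rfl⟩ : ∃ e, i = e + 1 := ⟨i - 1, by omega⟩
      by_cases he : p ∣ 1 + n * e
      -- The preceding degree is divisible by `p`, so the dominant term comes from two steps back,
      -- with binomial coefficient `(1 + n d)(n d)/2`. It is prime to `p` because `p ∤ n + 1` forces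
      -- `p ∤ n d`.
      · obtain ⟨d, rfl⟩ : ∃ d, e = d + 1 := by
          refine ⟨e - 1, ?_⟩
          rcases Nat.eq_zero_or_pos e with rfl | h
          · exact absurd (by simpa using he) hp.one_lt.ne'
          · omega
        have hpn' : ¬ p ∣ n := fun hd => hp.one_lt.ne' (Nat.dvd_one.mp
          ((Nat.dvd_add_left (hd.mul_right _)).mp he))
        have hd1 : ¬ p ∣ 1 + n * d := fun hd => hpn' (by
          rw [show 1 + n * (d + 1) = 1 + n * d + n by ring] at he
          exact (Nat.dvd_add_right hd).mp he)
        have hd2 : ¬ p ∣ n * d := fun hd => hpn (by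
          rw [show 1 + n * (d + 1) = n * d + (n + 1) by ring] at he
          exact (Nat.dvd_add_right hd).mp he)
        refine ⟨d, 2, rfl, two_pos, hd1, fun hc => ?_, ?_, fun i' hi' hgi' => ?_⟩
        · have h2 : (1 + n * d).choose 2 * 2 = (1 + n * d) * (n * d) := by
            have := Nat.add_one_mul_choose_eq (n * d) 1
            rw [Nat.choose_one_right] at this
            rw [add_comm 1 (n * d)]
            exact this.symm
          rcases hp.dvd_mul.mp (h2 ▸ hc.mul_right 2) with h | h
          · exact hd1 h
          · exact hd2 h
        · rw [smallDivisorProd_succ, smallDivisorProd_succ, smallDivisorFactor, if_pos he, mul_one,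
            smallDivisorFactor, if_neg hi]
        · have : i' ≠ d + 1 := fun h => hgi' (h ▸ he)
          omega
      · refine ⟨e, 1, rfl, one_pos, he, by rwa [Nat.choose_one_right], ?_, fun i' hi' _ => by omega⟩
        rw [smallDivisorProd_succ, smallDivisorFactor, if_neg hi]
    have hidx : ∀ x y, 1 + n * (x + y) = 1 + n * x + n * y := fun x y => by ring
    let t : ℕ → K := fun m => coeff m h * coeff (1 + n * i) (linearAddMonomial l a n ^ m)
    have ht₀ : ‖t (1 + n * i₀)‖ = ‖coeff 1 h‖ * ‖a‖ ^ i * smallDivisorProd p l n i₀ := by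
      simp only [t]
      rw [hij, hidx, coeff_linearAddMonomial_pow l a hn, norm_mul, ih i₀ (by omega) hgood, norm_mul,
        norm_mul, norm_pow, norm_pow, hl1, norm_natCast_eq_one_of_not_dvd hp hchoose, pow_add]
      ring
    have ht₀pos : 0 < ‖t (1 + n * i₀)‖ := by
      rw [ht₀]
      have := hB i₀
      positivity
    -- Every other nonzero term comes from an earlier degree prime to `p`. It carries the same total
    -- power of `‖a‖`, but a strictly smaller product of inverse divisors.
    have hdom : ∀ m ∈ Finset.range (1 + n * i), m ≠ 1 + n * i₀ → ‖t m‖ < ‖t (1 + n * i₀)‖ := by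
      intro m hm hne
      have hmk := Finset.mem_range.mp hm
      by_cases hz : t m = 0
      · rwa [hz, norm_zero]
      have hm0 : m ≠ 0 := by
        rintro rfl
        exact hz (by simp [t, h0])
      obtain ⟨j, hj⟩ : ∃ j, 1 + n * i = m + n * j := by
        by_contra hex
        refine hz ?_
        simp only [t]
        rw [coeff_linearAddMonomial_pow_eq_zero l a (fun j hj => hex ⟨j, hj⟩), mul_zero]
      have hji : j ≤ i := Nat.le_of_mul_le_mul_left (by omega : n * j ≤ n * i) hn
      obtain ⟨i', rfl⟩ := Nat.exists_eq_add_of_le' hji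
      obtain rfl : m = 1 + n * i' := by rw [hidx] at hj; omega
      have hj0 : 0 < j := Nat.pos_of_ne_zero (by rintro rfl; simp at hmk)
      have htm : t (1 + n * i') = coeff (1 + n * i') h *
          (a ^ j * l ^ (1 + n * i' - j) * ((1 + n * i').choose j : K)) := by
        simp only [t]
        rw [hj, coeff_linearAddMonomial_pow l a hn]
      have hgi' : ¬ p ∣ 1 + n * i' := by
        intro hd
        have hpj : ¬ p ∣ j := fun hpj => hi (by rw [hj]; exact dvd_add hd (hpj.mul_left n))
        exact hz (by rw [htm, natCast_choose_eq_zero hp hd hpj, mul_zero, mul_zero])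
      have hlt : i' < i₀ := lt_of_le_of_ne (hlast i' (by omega) hgi') (by rintro rfl; exact hne rfl)
      rw [ht₀, htm, norm_mul, ih i' (by omega) hgi', pow_add]
      calc _ ≤ ‖coeff 1 h‖ * ‖a‖ ^ i' * smallDivisorProd p l n i' * ‖a‖ ^ j := by
            have := hB i'
            exact mul_le_mul_of_nonneg_left (norm_binomial_coeff_le l a hl1 _ _) (by positivity)
        _ = ‖coeff 1 h‖ * (‖a‖ ^ i' * ‖a‖ ^ j) * smallDivisorProd p l n i' := by ring
        _ < _ := mul_lt_mul_of_pos_left (smallDivisorProd_lt hroot hl hn hlt hgood) (by positivity)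
    have hsum : ‖∑ m ∈ Finset.range (1 + n * i), t m‖ = ‖t (1 + n * i₀)‖ := by
      refine norm_sum_eq_of_forall_lt (Finset.mem_range.mpr ?_) ht₀pos hdom
      rw [hij, hidx]
      have := Nat.mul_pos hn hj₀
      omega
    have hdiv : ‖l - l ^ (1 + n * i)‖ = ‖1 - l ^ (n * i)‖ := by
      rw [show l - l ^ (1 + n * i) = l * (1 - l ^ (n * i)) by ring, norm_mul, hl1, one_mul]
    have hdiv0 : ‖1 - l ^ (n * i)‖ ≠ 0 :=
      norm_ne_zero_iff.mpr (sub_ne_zero.mpr (hroot _ (Nat.mul_pos hn hi0)).symm)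
    have hrec := congrArg norm (H (1 + n * i))
    rw [norm_mul, hdiv, hsum, ht₀] at hrec
    rw [hprod, ← mul_assoc, ← hrec, mul_assoc, mul_inv_cancel₀ hdiv0, mul_one]

lemma not_isLocallyAnalytic_linearization {p : ℕ} (hp : p.Prime) [CharP K p] {l a : K}
    (hroot : ∀ m : ℕ, 0 < m → l ^ m ≠ 1) (hl : ‖1 - l‖ < 1) {n : ℕ} (hn : 1 ≤ n)
    (hpn : ¬ p ∣ n + 1) (ha : a ≠ 0) {h : PowerSeries K} (h0 : constantCoeff h = 0)
    (h1 : coeff 1 h ≠ 0) (H : subst (linearAddMonomial l a n) h = C l * h) :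
    ¬ IsLocallyAnalytic h := by
  intro hh
  have ht0 : 1 - l ≠ 0 := sub_ne_zero.mpr (by simpa using (hroot 1 one_pos).symm)
  obtain ⟨z, hz, c, hc⟩ := hh.exists_norm_coeff_bound ht0 hl
  have hR := one_lt_inv_norm_one_sub hroot hl
  have hz' : 0 < ‖z‖ := norm_pos_iff.mpr hz
  have ha' : 0 < ‖a‖ := norm_pos_iff.mpr ha
  have hb1 : 0 < ‖coeff 1 h‖ := norm_pos_iff.mpr h1
  set R := ‖1 - l‖⁻¹
  set δ := ‖a‖ ^ p * ‖z‖ ^ (n * p) with hδ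
  have hδ0 : 0 < δ := by positivity
  -- As `p^(N+1) = p * p^N`, the powers of `‖a‖` and `‖z‖` collect into `δ^(p^N)`. Once `δ R^N ≥ 2`,
  -- the term is at least `‖b₁‖ ‖z‖ 2^(p^N)`, which exceeds `c`.
  obtain ⟨N, hN1, hN2⟩ := (((tendsto_pow_atTop_atTop_of_one_lt hR).eventually_ge_atTop (2 / δ)).and
    ((tendsto_pow_atTop_atTop_of_one_lt (one_lt_two (α := ℝ))).eventually_gt_atTop
      (c / (‖coeff 1 h‖ * ‖z‖)))).exists
  have hgood : ¬ p ∣ 1 + n * p ^ (N + 1) := fun hd => hp.one_lt.ne' (Nat.dvd_one.mp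
    ((Nat.dvd_add_left ((dvd_pow_self p N.succ_ne_zero).mul_left n)).mp hd))
  have hcN := hc (1 + n * p ^ (N + 1))
  rw [norm_coeff_linearization_eq hp hroot hl hn hpn ha h0 h1 H hgood] at hcN
  have hlow : ‖coeff 1 h‖ * ‖z‖ * 2 ^ N ≤ c := by
    refine le_trans ?_ hcN
    calc ‖coeff 1 h‖ * ‖z‖ * 2 ^ N ≤ ‖coeff 1 h‖ * ‖z‖ * 2 ^ (p ^ N) := by
          gcongr
          · exact one_le_two
          · exact (Nat.lt_pow_self hp.one_lt).le
      _ ≤ ‖coeff 1 h‖ * ‖z‖ * (δ * R ^ N) ^ (p ^ N) := by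
          gcongr
          rw [div_le_iff₀ hδ0] at hN1
          linarith
      _ = ‖coeff 1 h‖ * ‖a‖ ^ p ^ (N + 1) * R ^ (N * p ^ N) * ‖z‖ ^ (1 + n * p ^ (N + 1)) := by
          rw [hδ, mul_pow, mul_pow, ← pow_mul, ← pow_mul, ← pow_mul, pow_add ‖z‖, pow_one,
            pow_succ' p N, mul_assoc n]
          ring
      _ ≤ _ := by
          gcongr
          exact inv_norm_pow_le_smallDivisorProd hp hroot hl hn N
  rw [div_lt_iff₀ (by positivity)] at hN2
  linarith

end Divergence

theorem theorem1p4 {K : Type*} [NormedField K] [CompleteSpace K] [IsUltrametricDist K]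
    (p : ℕ) (hp : p.Prime) (hp3 : 3 ≤ p) [CharP K p]
    (l : K) (hroot : ∀ m : ℕ, 0 < m → l ^ m ≠ 1) (hl : ‖1 - l‖ < 1)
    (n : ℕ) (hn : 1 ≤ n) (a : K) :
    IsLinearizable
        ((Polynomial.C l * Polynomial.X + Polynomial.C a * Polynomial.X ^ (n + 1) :
          Polynomial K) : PowerSeries K) ↔
      p ∣ n + 1 ∨ a = 0 := by
  have hf : ((Polynomial.C l * Polynomial.X + Polynomial.C a * Polynomial.X ^ (n + 1) :
      Polynomial K) : PowerSeries K) = PowerSeries.linearAddMonomial l a n := by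
    simp [PowerSeries.linearAddMonomial]
  rw [hf, isLinearizable_iff_exists_semiconj (PowerSeries.constantCoeff_linearAddMonomial l a n),
    PowerSeries.coeff_one_linearAddMonomial l a hn]
  constructor
  · rintro ⟨h, hh, h0, h1, H⟩
    by_contra hcon
    push Not at hcon
    exact not_isLocallyAnalytic_linearization hp hroot hl hn hcon.1 hcon.2 h0 h1 H hh
  · rintro (hpn | rfl)
    · have hl0 : l ≠ 0 := by
        rintro rfl
        simp at hl
      obtain ⟨h, h0, h1, H⟩ := PowerSeries.exists_formal_linearization hl0 hroot a hn
      exact ⟨h, IsLocallyAnalytic.of_norm_coeff_le (by positivity)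
        (norm_coeff_linearization_le hp hroot hl hn hpn h0 h1 H), h0, by simp [h1], H⟩
    -- For `a = 0` the map is already linear and the identity conjugates it.
    · refine ⟨PowerSeries.X, IsLocallyAnalytic.of_norm_coeff_le one_pos fun k => ?_, by simp,
        by simp, ?_⟩
      · rw [PowerSeries.coeff_X]
        split_ifs <;> simp
      · rw [PowerSeries.subst_X (PowerSeries.HasSubst.of_constantCoeff_zero'
          (PowerSeries.constantCoeff_linearAddMonomial l 0 n))]
        simp [PowerSeries.linearAddMonomial]
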